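/- Let $\Omega\subset\mathbb{R}^N$ be a bounded open set with Lipschitz boundary (connectedness is not required), i.e. near each boundary point $\Omega$ is, in suitable orthonormal coordinates, the region strictly above the graph of a Lipschitz function, and let $A:\mathbb{R}^N\to\mathbb{R}^N$ be Lebesgue measurable and locally bounded. For $u\in L^1(\Omega,\mathbb{C})$, with $\|u\|_{L^1(\Omega)}:=\int_\Omega(|\Re u|+|\Im u|)\,dx$, put $|Du|_A(\Omega):=C_{1,A,u}(\Omega)+C_{2,A,u}(\Omega)$, where $$C_{1,A,u}(\Omega):=\sup_{\varphi}\int_\Omega \Re u\,\operatorname{div}\varphi-(A\cdot\varphi)\,\Im u\,dx,\qquad C_{2,A,u}(\Omega):=\sup_{\varphi}\int_\Omega \Im u\,\operatorname{div}\varphi+(A\cdot\varphi)\,\Re u\,dx,$$ both suprema being over all $\varphi\in C_c^\infty(\Omega,\mathbb{R}^N)$ with $|\varphi(x)|\le 1$ for all $x$. Let $BV_A(\Omega)$ be the space of all $u\in L^1(\Omega,\mathbb{C})$ with $|Du|_A(\Omega)<\infty$, with norm $\|u\|_{BV_A(\Omega)}:=\|u\|_{L^1(\Omega)}+|Du|_A(\Omega)$.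 Let $(u_k)_{k\in\mathbb{N}}$ be a sequence in $BV_A(\Omega)$ with $\sup_k\|u_k\|_{BV_A(\Omega)}<\infty$. Then there exist a subsequence $(u_{k_j})_j$ and a function $u\in BV_A(\Omega)$ such that $\|u_{k_j}-u\|_{L^1(\Omega)}\to 0$ as $j\to\infty$. -/

import Mathlib

open MeasureTheory Filter Topology TopologicalSpace
open scoped Distributions NNReal ENNReal

noncomputable section

namespace MagneticBV

/-- An open set `Ω` has Lipschitz boundary if near every boundary point, in suitable orthonormal
coordinates, `Ω` is the set of points strictly above the graph of a Lipschitz function. Here `ν` is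
the direction of the last coordinate and the orthogonal complement of `ν` carries the others. -/
def HasLipschitzBoundary {N : ℕ} (Ω : Opens (EuclideanSpace ℝ (Fin N))) : Prop :=
  ∀ x₀ ∈ frontier (Ω : Set (EuclideanSpace ℝ (Fin N))),
    ∃ (ν : EuclideanSpace ℝ (Fin N)) (r : ℝ) (K : ℝ≥0) (γ : (ℝ ∙ ν)ᗮ → ℝ),
      ‖ν‖ = 1 ∧ 0 < r ∧ LipschitzWith K γ ∧
        ∀ y ∈ Metric.ball x₀ r,
          y ∈ Ω ↔ γ ((ℝ ∙ ν)ᗮ.orthogonalProjectionOnto y) < inner ℝ ν y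

/-- A vector field is locally bounded if every point has a neighbourhood on which it is bounded. -/
def IsLocallyBounded {N : ℕ} (A : EuclideanSpace ℝ (Fin N) → EuclideanSpace ℝ (Fin N)) : Prop :=
  ∀ x, ∃ U ∈ 𝓝 x, Bornology.IsBounded (A '' U)

/-- The divergence of a vector field, the sum of the `∂ᵢ φᵢ`. -/
def divergence {N : ℕ} (φ : EuclideanSpace ℝ (Fin N) → EuclideanSpace ℝ (Fin N))
    (x : EuclideanSpace ℝ (Fin N)) : ℝ :=
  ∑ i : Fin N, (fderiv ℝ φ x (EuclideanSpace.single i 1)) i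

/-- `C_{1,A,u}(Ω)`. The supremum contains the value `0` (at `φ = 0`), so nothing is lost by taking
it in `[0, ∞]`. -/
def variationRe {N : ℕ} (A : EuclideanSpace ℝ (Fin N) → EuclideanSpace ℝ (Fin N))
    (Ω : Opens (EuclideanSpace ℝ (Fin N))) (u : EuclideanSpace ℝ (Fin N) → ℂ) : ℝ≥0∞ :=
  ⨆ (φ : 𝓓(Ω, EuclideanSpace ℝ (Fin N))) (_ : ∀ x, ‖φ x‖ ≤ 1),
    ENNReal.ofReal (∫ x in (Ω : Set (EuclideanSpace ℝ (Fin N))),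
      ((u x).re * divergence φ x - inner ℝ (A x) (φ x) * (u x).im))

/-- `C_{2,A,u}(Ω)`, again a supremum of a family that contains `0`. -/
def variationIm {N : ℕ} (A : EuclideanSpace ℝ (Fin N) → EuclideanSpace ℝ (Fin N))
    (Ω : Opens (EuclideanSpace ℝ (Fin N))) (u : EuclideanSpace ℝ (Fin N) → ℂ) : ℝ≥0∞ :=
  ⨆ (φ : 𝓓(Ω, EuclideanSpace ℝ (Fin N))) (_ : ∀ x, ‖φ x‖ ≤ 1),
    ENNReal.ofReal (∫ x in (Ω : Set (EuclideanSpace ℝ (Fin N))),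
      ((u x).im * divergence φ x + inner ℝ (A x) (φ x) * (u x).re))

/-- The magnetic total variation `|Du|_A(Ω)`. -/
def variation {N : ℕ} (A : EuclideanSpace ℝ (Fin N) → EuclideanSpace ℝ (Fin N))
    (Ω : Opens (EuclideanSpace ℝ (Fin N))) (u : EuclideanSpace ℝ (Fin N) → ℂ) : ℝ≥0∞ :=
  variationRe A Ω u + variationIm A Ω u

/-- The norm of `L¹(Ω, ℂ)`, where `ℂ` carries the norm `|z|₁ = |Re z| + |Im z|`. -/
def l1Norm {N : ℕ} (Ω : Opens (EuclideanSpace ℝ (Fin N)))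
    (u : EuclideanSpace ℝ (Fin N) → ℂ) : ℝ≥0∞ :=
  ∫⁻ x in (Ω : Set (EuclideanSpace ℝ (Fin N))), (‖(u x).re‖ₑ + ‖(u x).im‖ₑ)

/-- `u ∈ BV_A(Ω)`. Functions on `Ω` are represented by functions on the whole space, of which only
the values on `Ω` matter. -/
def MemBV {N : ℕ} (A : EuclideanSpace ℝ (Fin N) → EuclideanSpace ℝ (Fin N))
    (Ω : Opens (EuclideanSpace ℝ (Fin N))) (u : EuclideanSpace ℝ (Fin N) → ℂ) : Prop :=
  IntegrableOn u (Ω : Set (EuclideanSpace ℝ (Fin N))) ∧ variation A Ω u < ∞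

/-- The norm of `BV_A(Ω)`. -/
def bvNorm {N : ℕ} (A : EuclideanSpace ℝ (Fin N) → EuclideanSpace ℝ (Fin N))
    (Ω : Opens (EuclideanSpace ℝ (Fin N))) (u : EuclideanSpace ℝ (Fin N) → ℂ) : ℝ≥0∞ :=
  l1Norm Ω u + variation A Ω u

end MagneticBV

end

/-! The magnetic term is a bounded perturbation: `Ω` is bounded, so `‖A‖ ≤ a` on `Ω`, and a bound
`C` on the norms gives `∫ p div φ ≤ C + |a| C` for `p` the real or imaginary part. What remains is
compactness of ordinary `BV` in `L¹` on a bounded Lipschitz domain, proved here without an extension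
operator.

Extend `p` by zero to `f`. Although `f` may jump across the boundary, a translation `f (x + w) - f
x` on an open set `V` costs at most `‖w‖ M` in `L¹(V)` as long as the segments from `x` to `x + w`
stay in `Ω`, because then only test fields supported in `Ω` occur
(`setLIntegral_enorm_comp_add_sub_le`). The Lipschitz condition supplies, near each point of the
closure, a cone of such translations `t • ν + h` with `‖h‖ ≤ c * t`. Averaging over these `h` gives
a mollification shifted into `Ω`, at `L¹(V)` distance at most `t (‖ν‖ + c) M` from `f`. For fixed
`t` these mollifications are uniformly bounded and equi-Lipschitz, hence totally bounded for uniform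
convergence on `V`, and therefore in `L¹(V)`. This is `L1TotallyBounded.of_hasLocalCone`;
compactness of the closure of `Ω` makes it global.

Completeness of `L¹` yields a convergent subsequence. For each fixed `φ` the magnetic functional is
`L¹`-continuous, so its bounds survive in the limit, which therefore lies in `BV_A(Ω)`. -/

namespace MagneticBV

/-! ### The `L¹` norm by duality with smooth functions -/

section Duality

variable {E : Type*} [NormedAddCommGroup E] [NormedSpace ℝ E] [FiniteDimensional ℝ E]
  [MeasurableSpace E] [BorelSpace E] {μ : Measure E} [μ.IsAddHaarMeasure]

/-- A bounded measurable function vanishing outside a compact subset `K` of the open set `V` is an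
almost everywhere limit of smooth functions with compact support in `V` and the same bound. -/
theorem exists_seq_smooth_tendsto_ae {V K : Set E} (hV : IsOpen V) (hK : IsCompact K)
    (hKV : K ⊆ V) {s : E → ℝ} (hs : Measurable s) (hs_le : ∀ x, |s x| ≤ 1)
    (hs_supp : Function.support s ⊆ K) :
    ∃ ψ : ℕ → E → ℝ, (∀ n, ContDiff ℝ (⊤ : ℕ∞) (ψ n)) ∧ (∀ n, HasCompactSupport (ψ n)) ∧
      (∀ n, tsupport (ψ n) ⊆ V) ∧ (∀ n x, |ψ n x| ≤ 1) ∧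
      ∀ᵐ x ∂μ, Tendsto (fun n => ψ n x) atTop (𝓝 (s x)) := by
  obtain ⟨δ, hδ, hδV⟩ := hK.exists_cthickening_subset_open hV hKV
  have hpos : ∀ n : ℕ, 0 < δ / (n + 1) := fun n => by positivity
  -- Outer radii at most `δ` keep the supports in the thickening of `K`. The ratio 2 of the radii is
  -- the bounded eccentricity needed for almost everywhere convergence.
  let b : ℕ → ContDiffBump (0 : E) := fun n =>
    ⟨δ / (n + 1) / 2, δ / (n + 1), half_pos (hpos n), half_lt_self (hpos n)⟩
  have hts : tsupport s ⊆ K := closure_minimal hs_supp hK.isClosed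
  have hcs : HasCompactSupport s := hK.of_isClosed_subset (isClosed_tsupport s) hts
  have hint : Integrable s μ := by
    refine (integrableOn_iff_integrable_of_support_subset hs_supp).1 ?_
    exact Measure.integrableOn_of_bounded (M := 1) hK.measure_lt_top.ne hs.aestronglyMeasurable
      (Eventually.of_forall fun x => by simpa using hs_le x)
  let ψ : ℕ → E → ℝ := fun n =>
    MeasureTheory.convolution ((b n).normed μ) s (ContinuousLinearMap.lsmul ℝ ℝ) μ
  have hsub : ∀ n, tsupport (ψ n) ⊆ Metric.cthickening δ K := fun n => by
    refine closure_minimal ?_ Metric.isClosed_cthickening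
    refine (support_convolution_subset _).trans ?_
    rintro _ ⟨x, hx, y, hy, rfl⟩
    rw [ContDiffBump.support_normed_eq, mem_ball_zero_iff] at hx
    refine Metric.mem_cthickening_of_dist_le _ y _ _ (hs_supp hy) ?_
    rw [dist_eq_norm, add_sub_cancel_right]
    refine hx.le.trans (div_le_self hδ.le ?_)
    linarith [(Nat.cast_nonneg n : (0 : ℝ) ≤ n)]
  refine ⟨ψ, fun n => ?_, fun n => ?_, fun n => (hsub n).trans hδV, fun n x => ?_, ?_⟩
  · exact (b n).hasCompactSupport_normed.contDiff_convolution_left _ (b n).contDiff_normed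
      hint.locallyIntegrable
  · exact hK.cthickening.of_isClosed_subset (isClosed_tsupport _) (hsub n)
  · calc |ψ n x| ≤ ∫ t, ‖(b n).normed μ t * s (x - t)‖ ∂μ := by
          simpa [ψ, MeasureTheory.convolution] using
            norm_integral_le_integral_norm (μ := μ) (fun t => (b n).normed μ t * s (x - t))
      _ ≤ ∫ t, (b n).normed μ t ∂μ := by
          refine integral_mono_of_nonneg (Eventually.of_forall fun t => norm_nonneg _)
            (b n).integrable_normed (Eventually.of_forall fun t => ?_)
          simp only [norm_mul, Real.norm_eq_abs, abs_of_nonneg ((b n).nonneg_normed t)]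
          exact mul_le_of_le_one_right ((b n).nonneg_normed t) (hs_le _)
      _ = 1 := (b n).integral_normed
  · refine ContDiffBump.ae_convolution_tendsto_right_of_locallyIntegrable (K := 2) ?_ ?_
      hint.locallyIntegrable
    · simpa [b, Function.comp_def] using
        (tendsto_const_div_atTop_nhds_zero_nat δ).comp (tendsto_add_atTop_nat 1)
    · exact Eventually.of_forall fun n => by simp [b]; linarith

/-- The `L¹` norm on an open set is controlled by testing against smooth functions. -/
theorem setLIntegral_enorm_le_of_forall_smooth {V : Set E} (hV : IsOpen V) {g : E → ℝ}
    (hg : Integrable g μ) {C : ℝ}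
    (hC : ∀ ψ : E → ℝ, ContDiff ℝ (⊤ : ℕ∞) ψ → HasCompactSupport ψ → tsupport ψ ⊆ V →
      (∀ x, |ψ x| ≤ 1) → ∫ x, g x * ψ x ∂μ ≤ C) :
    ∫⁻ x in V, ‖g x‖ₑ ∂μ ≤ ENNReal.ofReal C := by
  have hcpt : ∀ K ⊆ V, IsCompact K → ∫⁻ x in K, ‖g x‖ₑ ∂μ ≤ ENNReal.ofReal C := by
    intro K hKV hK
    obtain ⟨g', hg', hgg'⟩ := hg.aestronglyMeasurable
    -- The extremal test function is the sign of `g` cut off to `K`; its smooth approximations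
    -- recover `∫ |g|` over `K` by dominated convergence.
    obtain ⟨ψ, h1, h2, h3, h4, h5⟩ := exists_seq_smooth_tendsto_ae (μ := μ) hV hK hKV
      (s := K.indicator fun x => (SignType.sign (g' x) : ℝ))
      (by
        refine Measurable.indicator ?_ hK.measurableSet
        have : Measurable fun y : ℝ => ((SignType.sign y : SignType) : ℝ) := by
          have h : (fun y : ℝ => ((SignType.sign y : SignType) : ℝ)) =
              fun y => if 0 < y then 1 else if y < 0 then -1 else 0 := by
            ext y
            rw [sign_apply]
            split_ifs <;> simp
          rw [h]
          exact Measurable.ite measurableSet_Ioi measurable_const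
            (Measurable.ite measurableSet_Iio measurable_const measurable_const)
        exact this.comp hg'.measurable)
      (by
        intro x
        by_cases hx : x ∈ K
        · rw [Set.indicator_of_mem hx]
          rcases SignType.trichotomy (SignType.sign (g' x)) with h | h | h <;> simp [h]
        · simp [hx])
      Set.support_indicator_subset
    have hlim : Tendsto (fun n => ∫ x, g x * ψ n x ∂μ) atTop
        (𝓝 (∫ x, K.indicator (fun x => ‖g x‖) x ∂μ)) := by
      refine tendsto_integral_of_dominated_convergence (fun x => ‖g x‖)
        (fun n => hg.aestronglyMeasurable.mul (h1 n).continuous.aestronglyMeasurable) hg.norm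
        (fun n => Eventually.of_forall fun x => ?_) ?_
      · rw [norm_mul]
        exact mul_le_of_le_one_right (norm_nonneg _) (h4 n x)
      · filter_upwards [h5, hgg'] with x hx hxg
        convert hx.const_mul (g x) using 2
        by_cases hxK : x ∈ K
        · rw [Set.indicator_of_mem hxK, Set.indicator_of_mem hxK, ← hxg, mul_comm,
            sign_mul_self, Real.norm_eq_abs]
        · simp [hxK]
    have hle := le_of_tendsto' hlim fun n => hC _ (h1 n) (h2 n) (h3 n) (h4 n)
    rw [integral_indicator hK.measurableSet] at hle
    rw [← ofReal_integral_norm_eq_lintegral_enorm hg.integrableOn]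
    exact ENNReal.ofReal_le_ofReal hle
  -- Finiteness of the measure `|g| μ` gives its inner regularity, so `V` is exhausted by compact
  -- sets.
  have hfin : IsFiniteMeasure (μ.withDensity fun x => ‖g x‖ₑ) :=
    isFiniteMeasure_withDensity hg.hasFiniteIntegral.ne
  rw [← withDensity_apply _ hV.measurableSet, hV.measure_eq_iSup_isCompact]
  refine iSup₂_le fun K hKV => iSup_le fun hK => ?_
  rw [withDensity_apply _ hK.measurableSet]
  exact hcpt K hKV hK

end Duality

/-! ### Translation estimates -/

/-- Testing against directional derivatives, for a function of bounded variation. -/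
theorem abs_integral_mul_fderiv_le {N : ℕ} {Ω : Opens (EuclideanSpace ℝ (Fin N))}
    {f : EuclideanSpace ℝ (Fin N) → ℝ} {M : ℝ}
    (hM : ∀ φ : 𝓓(Ω, EuclideanSpace ℝ (Fin N)), (∀ x, ‖φ x‖ ≤ 1) →
      ∫ x, f x * divergence φ x ≤ M)
    {ψ : EuclideanSpace ℝ (Fin N) → ℝ} (hψ : ContDiff ℝ (⊤ : ℕ∞) ψ) (hψc : HasCompactSupport ψ)
    (hψΩ : tsupport ψ ⊆ Ω) (hψ1 : ∀ x, |ψ x| ≤ 1) (w : EuclideanSpace ℝ (Fin N)) :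
    |∫ x, f x * fderiv ℝ ψ x w| ≤ ‖w‖ * M := by
  -- The derivative of `ψ` along `a` is the divergence of the field `ψ • a`. Using `a = ± w / ‖w‖`
  -- then bounds the absolute value.
  have key : ∀ a : EuclideanSpace ℝ (Fin N), ‖a‖ ≤ 1 → ∫ x, f x * fderiv ℝ ψ x a ≤ M := by
    intro a ha
    have hsm : tsupport (fun x => ψ x • a) ⊆ tsupport ψ :=
      closure_mono (Function.support_smul_subset_left ψ fun _ => a)
    refine le_trans (le_of_eq (integral_congr_ae (Eventually.of_forall fun x => ?_)))
      (hM ⟨fun x => ψ x • a, hψ.smul contDiff_const, hψc.smul_right, hsm.trans hψΩ⟩ fun x => ?_)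
    · show f x * _ = f x * divergence (fun x => ψ x • a) x
      have hd : DifferentiableAt ℝ ψ x := hψ.differentiable (by simp) x
      congr 1
      simp only [divergence, fderiv_smul_const hd, ContinuousLinearMap.smulRight_apply,
        PiLp.smul_apply, smul_eq_mul]
      conv_lhs => rw [← (EuclideanSpace.basisFun (Fin N) ℝ).sum_repr a]
      simp [mul_comm]
    · show ‖ψ x • a‖ ≤ 1
      rw [norm_smul]
      exact mul_le_one₀ (hψ1 x) (norm_nonneg _) ha
  rcases eq_or_ne w 0 with rfl | hw
  · simp
  have hw' : 0 < ‖w‖ := norm_pos_iff.2 hw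
  have hn : ‖‖w‖⁻¹ • w‖ ≤ 1 := by
    rw [norm_smul, norm_inv, norm_norm, inv_mul_cancel₀ hw'.ne']
  have h1 := key _ hn
  have h2 := key (-(‖w‖⁻¹ • w)) (by rwa [norm_neg])
  simp only [map_neg, map_smul, smul_eq_mul, mul_neg, integral_neg, mul_left_comm (f _),
    integral_const_mul] at h1 h2
  rw [inv_mul_le_iff₀ hw'] at h1
  rw [← mul_neg, inv_mul_le_iff₀ hw'] at h2
  exact abs_le.2 ⟨by linarith, h1⟩

/-- Translating a test function by `w` changes the integral against a function of bounded variation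
by at most `‖w‖` times the variation, as long as the translated supports stay in the domain. -/
theorem abs_integral_mul_comp_sub_sub_le {N : ℕ} {Ω : Opens (EuclideanSpace ℝ (Fin N))}
    {f : EuclideanSpace ℝ (Fin N) → ℝ} (hf : Integrable f) {M : ℝ}
    (hM : ∀ φ : 𝓓(Ω, EuclideanSpace ℝ (Fin N)), (∀ x, ‖φ x‖ ≤ 1) →
      ∫ x, f x * divergence φ x ≤ M)
    {ψ : EuclideanSpace ℝ (Fin N) → ℝ} (hψ : ContDiff ℝ (⊤ : ℕ∞) ψ) (hψc : HasCompactSupport ψ)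
    (hψ1 : ∀ x, |ψ x| ≤ 1) {w : EuclideanSpace ℝ (Fin N)}
    (hw : ∀ x ∈ tsupport ψ, ∀ s ∈ Set.Icc (0 : ℝ) 1, x + s • w ∈ Ω) :
    |∫ x, f x * (ψ (x - w) - ψ x)| ≤ ‖w‖ * M := by
  have hcs : Continuous (fderiv ℝ ψ) := hψ.continuous_fderiv (by simp)
  obtain ⟨B, hB⟩ := hcs.bounded_above_of_compact_support (hψc.fderiv ℝ)
  have hint : ∀ s : ℝ, Integrable fun x => f x * ψ (x - s • w) := fun s =>
    hf.mul_bdd (c := 1) (hψ.continuous.comp (by fun_prop)).aestronglyMeasurable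
      (Eventually.of_forall fun x => hψ1 _)
  -- The translation acts on the smooth factor, so no derivative of `f` is needed; the mean value
  -- inequality in `s` on `[0, 1]` then finishes.
  have hder : ∀ s : ℝ, HasDerivAt (fun s : ℝ => ∫ x, f x * ψ (x - s • w))
      (∫ x, f x * fderiv ℝ ψ (x - s • w) (-w)) s := by
    intro s
    refine (hasDerivAt_integral_of_dominated_loc_of_deriv_le (s := Set.univ)
      (F := fun s x => f x * ψ (x - s • w))
      (F' := fun s x => f x * fderiv ℝ ψ (x - s • w) (-w))
      (bound := fun x => ‖f x‖ * (B * ‖w‖)) univ_mem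
      (Eventually.of_forall fun s => (hint s).aestronglyMeasurable) (hint s) ?_ ?_
      (hf.norm.mul_const _) ?_).2
    · exact hf.aestronglyMeasurable.mul
        (((hcs.comp (by fun_prop : Continuous fun x => x - s • w)).clm_apply
          continuous_const).aestronglyMeasurable)
    · refine Eventually.of_forall fun x s _ => ?_
      rw [norm_mul]
      refine mul_le_mul_of_nonneg_left ?_ (norm_nonneg _)
      refine (ContinuousLinearMap.le_opNorm _ _).trans ?_
      rw [norm_neg]
      exact mul_le_mul_of_nonneg_right (hB _) (norm_nonneg _)
    · refine Eventually.of_forall fun x s _ => HasDerivAt.const_mul _ ?_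
      have h1 : HasDerivAt (fun s : ℝ => x - s • w) (-w) s := by
        simpa using ((hasDerivAt_id s).smul_const w).const_sub x
      exact (hψ.differentiable (by simp) (x - s • w)).hasFDerivAt.comp_hasDerivAt s h1
  have hbound : ∀ s ∈ Set.Ico (0 : ℝ) 1, ‖∫ x, f x * fderiv ℝ ψ (x - s • w) (-w)‖ ≤ ‖w‖ * M := by
    intro s hs
    have hsupp : tsupport (fun x => ψ (x - s • w)) ⊆ (fun x => x - s • w) ⁻¹' tsupport ψ :=
      tsupport_comp_subset_preimage ψ (by fun_prop)
    have h := abs_integral_mul_fderiv_le hM (ψ := fun x => ψ (x - s • w))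
      (hψ.comp (contDiff_id.sub contDiff_const))
      (hψc.comp_homeomorph (Homeomorph.subRight (s • w)))
      (fun x hx => by simpa using hw _ (hsupp hx) s ⟨hs.1, hs.2.le⟩) (fun x => hψ1 _) (-w)
    simpa only [fderiv_comp_sub, norm_neg, Real.norm_eq_abs] using h
  have h := norm_image_sub_le_of_norm_deriv_le_segment_01'
    (fun s _ => (hder s).hasDerivWithinAt) hbound
  have h1 := hint 1
  have h0 := hint 0
  simp only [one_smul, zero_smul, sub_zero] at h h1 h0
  rw [← integral_sub h1 h0, Real.norm_eq_abs] at h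
  simpa only [mul_sub] using h

/-- Translations of a function of bounded variation are close to it in `L¹`, on open sets whose
translates stay in the domain. -/
theorem setLIntegral_enorm_comp_add_sub_le {N : ℕ} {Ω : Opens (EuclideanSpace ℝ (Fin N))}
    {f : EuclideanSpace ℝ (Fin N) → ℝ} (hf : Integrable f) {M : ℝ}
    (hM : ∀ φ : 𝓓(Ω, EuclideanSpace ℝ (Fin N)), (∀ x, ‖φ x‖ ≤ 1) →
      ∫ x, f x * divergence φ x ≤ M)
    {V : Set (EuclideanSpace ℝ (Fin N))} (hV : IsOpen V) {w : EuclideanSpace ℝ (Fin N)}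
    (hw : ∀ x ∈ V, ∀ s ∈ Set.Icc (0 : ℝ) 1, x + s • w ∈ Ω) :
    ∫⁻ x in V, ‖f (x + w) - f x‖ₑ ≤ ENNReal.ofReal (‖w‖ * M) := by
  have hfw : Integrable fun x => f (x + w) := hf.comp_add_right w
  refine setLIntegral_enorm_le_of_forall_smooth hV (hfw.sub hf) fun ψ hψ hψc hψV hψ1 => ?_
  have h := abs_integral_mul_comp_sub_sub_le hf hM hψ hψc hψ1 fun x hx => hw x (hψV hx)
  have hb : ∀ {g : EuclideanSpace ℝ (Fin N) → ℝ}, Integrable g → Integrable fun x => g x * ψ x :=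
    fun hg => hg.mul_bdd (c := 1) hψ.continuous.aestronglyMeasurable
      (Eventually.of_forall fun x => hψ1 _)
  have hb' : Integrable fun x => f x * ψ (x - w) := by
    simpa using (hb hfw).comp_sub_right w
  have e : ∫ x, f (x + w) * ψ x = ∫ x, f x * ψ (x - w) := by
    simpa using integral_add_right_eq_self (fun x => f x * ψ (x - w)) w
  calc ∫ x, (f (x + w) - f x) * ψ x = ∫ x, f x * (ψ (x - w) - ψ x) := by
        simp only [sub_mul, mul_sub]
        rw [integral_sub (hb hfw) (hb hf), integral_sub hb' (hb hf), e]
    _ ≤ _ := (le_abs_self _).trans h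

/-! ### Shifted mollification -/

/-- The mollification of `f`, evaluated at `x + a`. -/
noncomputable def shiftMollify {E : Type*} [NormedAddCommGroup E] [NormedSpace ℝ E]
    [FiniteDimensional ℝ E] [MeasureSpace E] (b : ContDiffBump (0 : E)) (a : E) (f : E → ℝ) (x : E) : ℝ :=
  ∫ h, b.normed volume h * f (x + (a + h))

/-- If every translation by `a + h` with `‖h‖` small moves `f` by at most `C` in `L¹(V)`, then so
does the shifted mollification. -/
theorem setLIntegral_enorm_shiftMollify_sub_le {E : Type*} [NormedAddCommGroup E]
    [InnerProductSpace ℝ E] [FiniteDimensional ℝ E] [MeasurableSpace E] [BorelSpace E]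
    (b : ContDiffBump (0 : E)) (a : E) {f : E → ℝ} (hfm : Measurable f) (hf : Integrable f)
    {V : Set E} {C : ℝ≥0∞}
    (hC : ∀ h, ‖h‖ < b.rOut → ∫⁻ x in V, ‖f (x + (a + h)) - f x‖ₑ ≤ C) :
    ∫⁻ x in V, ‖shiftMollify b a f x - f x‖ₑ ≤ C := by
  have hk := b.integrable_normed (μ := volume)
  have hbd : ∀ y, ‖b.normed volume y‖ ≤ 1 / volume.real (Metric.closedBall (0 : E) b.rIn) :=
    fun y => by
      rw [Real.norm_of_nonneg (b.nonneg_normed y)]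
      exact b.normed_le_div_measure_closedBall_rIn volume y
  have hpt : ∀ x, ‖shiftMollify b a f x - f x‖ₑ ≤
      ∫⁻ h, ‖b.normed volume h‖ₑ * ‖f (x + (a + h)) - f x‖ₑ := by
    intro x
    have hi : Integrable fun h => b.normed volume h * f (x + (a + h)) := by
      refine Integrable.bdd_mul ?_ b.continuous_normed.aestronglyMeasurable
        (Eventually.of_forall hbd)
      simpa only [add_assoc] using hf.comp_add_left (x + a)
    have e : shiftMollify b a f x - f x = ∫ h, b.normed volume h * (f (x + (a + h)) - f x) := by
      simp only [mul_sub]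
      rw [integral_sub hi (hk.mul_const _), integral_mul_const, b.integral_normed, one_mul,
        shiftMollify]
    rw [e]
    refine (enorm_integral_le_lintegral_enorm _).trans (le_of_eq ?_)
    simp only [enorm_mul]
  have hkm : Measurable fun h : E => ‖b.normed volume h‖ₑ :=
    b.continuous_normed.measurable.enorm
  calc ∫⁻ x in V, ‖shiftMollify b a f x - f x‖ₑ
      ≤ ∫⁻ x in V, ∫⁻ h, ‖b.normed volume h‖ₑ * ‖f (x + (a + h)) - f x‖ₑ :=
        lintegral_mono hpt
    _ = ∫⁻ h, ∫⁻ x in V, ‖b.normed volume h‖ₑ * ‖f (x + (a + h)) - f x‖ₑ := by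
        refine lintegral_lintegral_swap (Measurable.aemeasurable ?_)
        exact (hkm.comp measurable_snd).mul
          ((hfm.comp (by fun_prop)).sub (hfm.comp measurable_fst)).enorm
    _ ≤ ∫⁻ h, ‖b.normed volume h‖ₑ * C := by
        refine lintegral_mono fun h => ?_
        have hm : Measurable fun x => ‖f (x + (a + h)) - f x‖ₑ :=
          ((hfm.comp (by fun_prop)).sub hfm).enorm
        rw [lintegral_const_mul _ hm]
        by_cases hh : ‖h‖ < b.rOut
        · gcongr
          exact hC h hh
        · have : b.normed volume h = 0 := by
            rw [← Function.notMem_support, b.support_normed_eq, mem_ball_zero_iff]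
            exact hh
          simp [this]
    _ = C := by
        rw [lintegral_mul_const _ hkm, ← ofReal_integral_norm_eq_lintegral_enorm hk]
        simp only [Real.norm_of_nonneg (b.nonneg_normed _), b.integral_normed, ENNReal.ofReal_one,
          one_mul]

/-- A shifted mollification is bounded and Lipschitz, with constants depending only on the kernel
and the `L¹` norm. -/
theorem exists_shiftMollify_bound {E : Type*} [NormedAddCommGroup E]
    [InnerProductSpace ℝ E] [FiniteDimensional ℝ E] [MeasurableSpace E] [BorelSpace E]
    (b : ContDiffBump (0 : E)) (a : E) (M : ℝ) :
    ∃ B L : ℝ, ∀ f : E → ℝ, Integrable f → ∫ x, ‖f x‖ ≤ M →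
      (∀ x, |shiftMollify b a f x| ≤ B) ∧
      ∀ x y, |shiftMollify b a f x - shiftMollify b a f y| ≤ L * ‖x - y‖ := by
  have hbd : ∀ y, ‖b.normed volume y‖ ≤ 1 / volume.real (Metric.closedBall (0 : E) b.rIn) :=
    fun y => by
      rw [Real.norm_of_nonneg (b.nonneg_normed y)]
      exact b.normed_le_div_measure_closedBall_rIn volume y
  have hbc : ContDiff ℝ (1 : ℕ∞) (b.normed (volume : Measure E)) := b.contDiff_normed
  obtain ⟨L, hL⟩ := hbc.lipschitzWith_of_hasCompactSupport b.hasCompactSupport_normed (by simp)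
  set B := 1 / volume.real (Metric.closedBall (0 : E) b.rIn) with hBdef
  have hB : 0 ≤ B := by positivity
  refine ⟨B * M, L * M, fun f hf hfM => ?_⟩
  -- A change of variables moves `x` into the kernel, so the sup and Lipschitz bounds are those of
  -- the kernel times `‖f‖₁`.
  have hrep : ∀ x, shiftMollify b a f x = ∫ y, b.normed volume (y - (x + a)) * f y := fun x => by
    rw [← integral_add_left_eq_self (fun y => b.normed volume (y - (x + a)) * f y) (x + a)]
    simp [shiftMollify, add_assoc]
  have hi : ∀ x, Integrable fun y => b.normed volume (y - (x + a)) * f y := fun x =>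
    hf.bdd_mul (b.continuous_normed.comp
      (by fun_prop : Continuous fun y => y - (x + a))).aestronglyMeasurable
      (Eventually.of_forall fun y => hbd _)
  have hle : ∀ {g : E → ℝ} {c : ℝ}, 0 ≤ c → (∀ y, |g y| ≤ c) → |∫ y, g y * f y| ≤ c * M := by
    intro g c hc hg
    calc |∫ y, g y * f y| ≤ ∫ y, c * ‖f y‖ := by
          rw [← Real.norm_eq_abs]
          refine norm_integral_le_of_norm_le (hf.norm.const_mul c) (Eventually.of_forall fun y => ?_)
          rw [norm_mul]
          exact mul_le_mul_of_nonneg_right (hg y) (norm_nonneg _)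
      _ = c * ∫ y, ‖f y‖ := integral_const_mul _ _
      _ ≤ c * M := mul_le_mul_of_nonneg_left hfM hc
  refine ⟨fun x => ?_, fun x y => ?_⟩
  · rw [hrep]
    exact hle hB fun y => hbd _
  · rw [hrep, hrep, ← integral_sub (hi x) (hi y)]
    simp only [← sub_mul]
    rw [mul_right_comm]
    refine hle (by positivity) fun z => ?_
    have h := hL.dist_le_mul (z - (x + a)) (z - (y + a))
    rw [Real.dist_eq, dist_eq_norm] at h
    convert h using 2
    rw [norm_sub_rev]
    congr 1
    abel

/-! ### Interior cones -/

/-- The points of `Ω` near `x₀` admit a uniform open cone of directions pointing into `Ω`. -/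
def HasLocalCone {E : Type*} [NormedAddCommGroup E] [NormedSpace ℝ E] (Ω : Set E) (x₀ : E) :
    Prop :=
  ∃ (ν : E) (r c t₀ : ℝ), 0 < r ∧ 0 < c ∧ 0 < t₀ ∧
    ∀ x ∈ Ω ∩ Metric.ball x₀ r, ∀ t, 0 < t → t < t₀ → ∀ h, ‖h‖ ≤ c * t → x + (t • ν + h) ∈ Ω

/-- Moving by `t • ν + h` raises the height by at least `t - ‖h‖`, while the graph below rises by at
most `K ‖h‖`. The point stays above the graph when `(K + 1) ‖h‖ ≤ t`, which dictates `c = 1 / (K +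
1)`. -/
theorem HasLipschitzBoundary.hasLocalCone {N : ℕ} {Ω : Opens (EuclideanSpace ℝ (Fin N))}
    (hΩ : HasLipschitzBoundary Ω) {x₀ : EuclideanSpace ℝ (Fin N)}
    (hx₀ : x₀ ∈ closure (Ω : Set (EuclideanSpace ℝ (Fin N)))) :
    HasLocalCone (Ω : Set (EuclideanSpace ℝ (Fin N))) x₀ := by
  by_cases hx : x₀ ∈ Ω
  · obtain ⟨r, hr, hball⟩ := Metric.isOpen_iff.1 Ω.isOpen x₀ hx
    -- At an interior point no preferred direction is needed: `ν = 0` and small perturbations remain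
    -- in the ball.
    refine ⟨0, r / 2, 1, r / 2, half_pos hr, one_pos, half_pos hr, fun x hx t _ ht h hh => ?_⟩
    refine hball ?_
    have h1 := hx.2
    rw [mem_ball_iff_norm] at h1 ⊢
    calc ‖x + (t • (0 : EuclideanSpace ℝ (Fin N)) + h) - x₀‖ = ‖(x - x₀) + h‖ := by
          congr 1; simp; abel
      _ ≤ ‖x - x₀‖ + ‖h‖ := norm_add_le _ _
      _ < r := by linarith
  · obtain ⟨ν, r, K, γ, hν, hr, hγ, hiff⟩ := hΩ x₀ ⟨hx₀, fun h => hx (interior_subset h)⟩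
    have hK : (0 : ℝ) < K + 1 := by positivity
    set c : ℝ := 1 / (K + 1) with hc
    have hc0 : 0 < c := by positivity
    have hKc : K * c + c = 1 := by rw [hc]; field_simp
    have hc1 : c ≤ 1 := by nlinarith [K.coe_nonneg]
    -- Since `c ≤ 1`, the displacement is at most `2 * t < r / 2`, so the graph description still
    -- applies at the new point.
    refine ⟨ν, r / 2, c, r / 4, half_pos hr, hc0, by positivity, fun x hx t ht0 ht h hh => ?_⟩
    have h1 := hx.2
    rw [mem_ball_iff_norm] at h1
    have hct : c * t ≤ t := mul_le_of_le_one_left ht0.le hc1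
    have htν : ‖t • ν‖ = t := by rw [norm_smul, hν, mul_one, Real.norm_of_nonneg ht0.le]
    have hy : x + (t • ν + h) ∈ Metric.ball x₀ r := by
      rw [mem_ball_iff_norm]
      calc ‖x + (t • ν + h) - x₀‖ = ‖(x - x₀) + (t • ν + h)‖ := by congr 1; abel
        _ ≤ ‖x - x₀‖ + (‖t • ν‖ + ‖h‖) := (norm_add_le _ _).trans (by gcongr; exact norm_add_le _ _)
        _ < r := by linarith
    have hx' := (hiff x (Metric.ball_subset_ball (half_le_self hr.le) hx.2)).1 hx.1
    refine (hiff _ hy).2 ?_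
    set P := (ℝ ∙ ν)ᗮ.orthogonalProjectionOnto
    have hPν : P ν = 0 := by
      refine Submodule.orthogonalProjectionOnto_orthogonal_apply_eq_zero ?_
      exact Submodule.mem_span_singleton_self ν
    have hP : P (x + (t • ν + h)) = P x + P h := by simp [hPν]
    have hPh : ‖P h‖ ≤ ‖h‖ := Submodule.norm_orthogonalProjectionOnto_apply_le _ h
    have hg : γ (P x + P h) ≤ γ (P x) + K * ‖h‖ := by
      have := hγ.dist_le_mul (P x + P h) (P x)
      rw [dist_eq_norm, dist_eq_norm, add_sub_cancel_left] at this
      have h2 := (le_abs_self _).trans this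
      nlinarith [K.coe_nonneg]
    have hin : inner ℝ ν (x + (t • ν + h)) = inner ℝ ν x + (t + inner ℝ ν h) := by
      rw [inner_add_right, inner_add_right, inner_smul_right, real_inner_self_eq_norm_sq, hν]
      ring
    have hνh : -‖h‖ ≤ inner ℝ ν h := by
      have := abs_real_inner_le_norm ν h
      rw [hν, one_mul] at this
      exact (abs_le.1 this).1
    rw [hP, hin]
    have : (K + 1) * ‖h‖ ≤ (K + 1) * (c * t) := by gcongr
    have e : ((K : ℝ) + 1) * (c * t) = t := by rw [hc]; field_simp
    linarith

/-! ### Total boundedness in `L¹` -/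

/-- The sequence `f` is totally bounded in `L¹(V)`, stated through finite colourings. -/
def L1TotallyBounded {E : Type*} [MeasureSpace E] (V : Set E) (f : ℕ → E → ℝ) : Prop :=
  ∀ ε : ℝ≥0∞, 0 < ε → ∃ (T : Type) (_ : Finite T) (c : ℕ → T),
    ∀ i j, c i = c j → ∫⁻ x in V, ‖f i x - f j x‖ₑ ≤ ε

theorem L1TotallyBounded.mono {E : Type*} [MeasureSpace E] {V W : Set E} {f : ℕ → E → ℝ}
    (h : L1TotallyBounded W f) (hVW : V ⊆ W) : L1TotallyBounded V f := fun ε hε => by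
  obtain ⟨T, hT, c, hc⟩ := h ε hε
  exact ⟨T, hT, c, fun i j hij => (lintegral_mono_set hVW).trans (hc i j hij)⟩

theorem L1TotallyBounded.union {E : Type*} [MeasureSpace E] {V W : Set E} {f : ℕ → E → ℝ}
    (hV : L1TotallyBounded V f) (hW : L1TotallyBounded W f) : L1TotallyBounded (V ∪ W) f := by
  intro ε hε
  obtain ⟨T₁, hT₁, c₁, hc₁⟩ := hV (ε / 2) (ENNReal.half_pos hε.ne')
  obtain ⟨T₂, hT₂, c₂, hc₂⟩ := hW (ε / 2) (ENNReal.half_pos hε.ne')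
  refine ⟨T₁ × T₂, inferInstance, fun i => (c₁ i, c₂ i), fun i j hij => ?_⟩
  rw [Prod.mk.injEq] at hij
  calc _ ≤ _ := lintegral_union_le _ _ _
    _ ≤ ε / 2 + ε / 2 := add_le_add (hc₁ i j hij.1) (hc₂ i j hij.2)
    _ = ε := ENNReal.add_halves ε

theorem L1TotallyBounded.of_isCompact {E : Type*} [TopologicalSpace E] [MeasureSpace E]
    {Ω K : Set E} (hK : IsCompact K) (hΩK : Ω ⊆ K) {f : ℕ → E → ℝ}
    (h : ∀ x ∈ K, ∃ U ∈ 𝓝 x, L1TotallyBounded (Ω ∩ U) f) : L1TotallyBounded Ω f := by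
  have := hK.induction_on (p := fun s => L1TotallyBounded (Ω ∩ s) f)
    (fun ε _ => ⟨Unit, inferInstance, fun _ => (), fun i j _ => by simp⟩)
    (fun s t hst ht => ht.mono (Set.inter_subset_inter_right _ hst))
    (fun s t hs ht => by rw [Set.inter_union_distrib_left]; exact hs.union ht)
    (fun x hx => by
      obtain ⟨U, hU, hUf⟩ := h x hx
      exact ⟨U, mem_nhdsWithin_of_mem_nhds hU, hUf⟩)
  rwa [Set.inter_eq_left.2 hΩK] at this

/-- A uniformly bounded, uniformly Lipschitz sequence on a totally bounded set is totally bounded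
for uniform convergence. -/
theorem exists_finite_coloring_of_lipschitz {E : Type*} [SeminormedAddCommGroup E] {V : Set E}
    (hV : TotallyBounded V) {g : ℕ → E → ℝ} {B L : ℝ} (hB : ∀ i, ∀ x ∈ V, |g i x| ≤ B)
    (hL : ∀ i, ∀ x ∈ V, ∀ y ∈ V, |g i x - g i y| ≤ L * ‖x - y‖) {ε : ℝ} (hε : 0 < ε) :
    ∃ (T : Type) (_ : Finite T) (c : ℕ → T),
      ∀ i j, c i = c j → ∀ x ∈ V, |g i x - g j x| ≤ ε := by
  have hδ : 0 < ε / 3 / (|L| + 1) := by positivity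
  obtain ⟨s, hsV, hs, hcov⟩ := Metric.finite_approx_of_totallyBounded hV _ hδ
  -- With a net of radius `ε / 3 / (|L| + 1)`, passing to a net point costs at most `ε / 3` for each
  -- function. The colour records the values on the net, rounded to a grid of mesh `ε / 3`, which
  -- costs the last third.
  have : Finite s := hs
  have e3 : 0 < ε / 3 := by positivity
  have hrange : ∀ i (y : s), ⌊g i y / (ε / 3)⌋ ∈ Set.Icc ⌊-B / (ε / 3)⌋ ⌊B / (ε / 3)⌋ := by
    intro i y
    have := abs_le.1 (hB i y (hsV y.2))
    exact ⟨Int.floor_le_floor (by gcongr; exact this.1), Int.floor_le_floor (by gcongr; exact this.2)⟩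
  -- Indexing by `Fin n` places the colours in `Type`, whatever the universe of `E`.
  obtain ⟨n, ⟨e⟩⟩ := Finite.exists_equiv_fin s
  refine ⟨Fin n → Set.Icc ⌊-B / (ε / 3)⌋ ⌊B / (ε / 3)⌋, inferInstance,
    fun i k => ⟨_, hrange i (e.symm k)⟩, fun i j hij x hx => ?_⟩
  obtain ⟨y, hys, hxy⟩ := Set.mem_iUnion₂.1 (hcov hx)
  have h1 : |g i y - g j y| ≤ ε / 3 := by
    have := congr_arg Subtype.val (congr_fun hij (e ⟨y, hys⟩))
    simp only [Equiv.symm_apply_apply] at this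
    have h2 := Int.abs_sub_lt_one_of_floor_eq_floor this
    rw [← sub_div, abs_div, abs_of_pos e3, div_lt_one e3] at h2
    exact h2.le
  have h2 : L * ‖x - y‖ ≤ ε / 3 := by
    rw [mem_ball_iff_norm, lt_div_iff₀ (by positivity)] at hxy
    nlinarith [le_abs_self L, norm_nonneg (x - y)]
  have h3 := (hL i x hx y (hsV hys)).trans h2
  have h4 := (hL j x hx y (hsV hys)).trans h2
  rw [abs_le] at *
  constructor <;> linarith

/-- Functions with uniformly bounded `L¹` norm and variation form a totally bounded sequence in
`L¹` near every point at which the domain has an interior cone. -/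
theorem L1TotallyBounded.of_hasLocalCone {N : ℕ} {Ω : Opens (EuclideanSpace ℝ (Fin N))}
    {x₀ : EuclideanSpace ℝ (Fin N)}
    (hx₀ : HasLocalCone (Ω : Set (EuclideanSpace ℝ (Fin N))) x₀)
    {f : ℕ → EuclideanSpace ℝ (Fin N) → ℝ} (hfm : ∀ k, Measurable (f k))
    (hf : ∀ k, Integrable (f k)) {M : ℝ} (hfM : ∀ k, ∫ x, ‖f k x‖ ≤ M)
    (hM : ∀ k, ∀ φ : 𝓓(Ω, EuclideanSpace ℝ (Fin N)), (∀ x, ‖φ x‖ ≤ 1) →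
      ∫ x, f k x * divergence φ x ≤ M) :
    ∃ U ∈ 𝓝 x₀, L1TotallyBounded (Ω ∩ U) f := by
  obtain ⟨ν, r, c, t₀, hr, hc, ht₀, hcone⟩ := hx₀
  refine ⟨Metric.ball x₀ r, Metric.ball_mem_nhds x₀ hr, ?_⟩
  set V := (Ω : Set (EuclideanSpace ℝ (Fin N))) ∩ Metric.ball x₀ r
  have hVo : IsOpen V := Ω.isOpen.inter Metric.isOpen_ball
  have hVb : TotallyBounded V := (isCompact_closedBall x₀ r).totallyBounded.subset
    (Set.inter_subset_right.trans Metric.ball_subset_closedBall)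
  have hM0 : 0 ≤ M := (integral_nonneg fun x => norm_nonneg _).trans (hfM 0)
  have hVfin : volume V ≠ ∞ :=
    ((measure_mono Set.inter_subset_right).trans_lt measure_ball_lt_top).ne
  intro ε hε
  obtain ⟨ε', hε'0, hε'⟩ : ∃ ε' : ℝ, 0 < ε' ∧ ENNReal.ofReal ε' ≤ ε := by
    obtain ⟨q, hq0, hq⟩ := ENNReal.lt_iff_exists_nnreal_btwn.1 hε
    exact ⟨q, by exact_mod_cast hq0, by simpa using hq.le⟩
  have hp : 0 < (‖ν‖ + c) * M + 1 := by positivity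
  -- The scale `t` makes the mollification error at most `ε' / 3`; the `+ 1` in the denominator
  -- covers the case where the product vanishes.
  obtain ⟨t, ht0, htt, htε⟩ : ∃ t, 0 < t ∧ t < t₀ ∧ t * (‖ν‖ + c) * M ≤ ε' / 3 := by
    refine ⟨min (t₀ / 2) (ε' / 3 / ((‖ν‖ + c) * M + 1)), by positivity,
      (min_le_left _ _).trans_lt (half_lt_self ht₀), ?_⟩
    have h1 := (le_div_iff₀ hp).1 (min_le_right (t₀ / 2) (ε' / 3 / ((‖ν‖ + c) * M + 1)))
    have h2 : 0 ≤ min (t₀ / 2) (ε' / 3 / ((‖ν‖ + c) * M + 1)) := by positivity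
    linarith
  let b : ContDiffBump (0 : EuclideanSpace ℝ (Fin N)) :=
    ⟨c * t / 2, c * t, by positivity, half_lt_self (by positivity)⟩
  have happrox : ∀ k, ∫⁻ x in V, ‖shiftMollify b (t • ν) (f k) x - f k x‖ₑ ≤
      ENNReal.ofReal (ε' / 3) := by
    intro k
    refine setLIntegral_enorm_shiftMollify_sub_le b (t • ν) (hfm k) (hf k) fun h hh => ?_
    have hh' : ‖h‖ ≤ c * t := hh.le
    refine (setLIntegral_enorm_comp_add_sub_le (hf k) (hM k) hVo ?_).trans
      (ENNReal.ofReal_le_ofReal ((mul_le_mul_of_nonneg_right ?_ hM0).trans htε))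
    · intro x hx s hs
      -- The cone is invariant under scaling: `s • (t • ν + h)` is a cone displacement with
      -- parameters `s * t` and `s • h`. The endpoint `s = 0` is separate because the cone requires
      -- a positive parameter.
      rcases hs.1.eq_or_lt with rfl | hs0
      · simpa using hx.1
      · have := hcone x hx (s * t) (by positivity) (by nlinarith [hs.2]) (s • h) (by
          rw [norm_smul, Real.norm_of_nonneg hs.1]; nlinarith)
        simpa only [smul_add, smul_smul, SetLike.mem_coe] using this
    · calc ‖t • ν + h‖ ≤ ‖t • ν‖ + ‖h‖ := norm_add_le _ _
        _ ≤ t * ‖ν‖ + c * t := by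
          rw [norm_smul, Real.norm_of_nonneg ht0.le]; gcongr
        _ = t * (‖ν‖ + c) := by ring
  obtain ⟨B, L, hBL⟩ := exists_shiftMollify_bound b (t • ν) M
  have hη : 0 < ε' / 3 / (volume.real V + 1) := by positivity
  obtain ⟨T, hT, col, hcol⟩ := exists_finite_coloring_of_lipschitz hVb
    (g := fun k => shiftMollify b (t • ν) (f k))
    (fun k x _ => (hBL (f k) (hf k) (hfM k)).1 x)
    (fun k x _ y _ => (hBL (f k) (hf k) (hfM k)).2 x y) hη
  refine ⟨T, hT, col, fun i j hij => le_trans ?_ hε'⟩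
  set S := fun k => shiftMollify b (t • ν) (f k)
  have hSm : ∀ k, Measurable (S k) := fun k => by
    have hL : LipschitzWith L.toNNReal (S k) := LipschitzWith.of_dist_le_mul fun x y => by
      rw [Real.dist_eq, dist_eq_norm]
      refine ((hBL (f k) (hf k) (hfM k)).2 x y).trans ?_
      gcongr
      exact Real.le_coe_toNNReal L
    exact hL.continuous.measurable
  have hmid : ∫⁻ x in V, ‖S i x - S j x‖ₑ ≤ ENNReal.ofReal (ε' / 3) := by
    calc ∫⁻ x in V, ‖S i x - S j x‖ₑ
        ≤ ∫⁻ x in V, ENNReal.ofReal (ε' / 3 / (volume.real V + 1)) := by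
          refine setLIntegral_mono' hVo.measurableSet fun x hx => ?_
          rw [Real.enorm_eq_ofReal_abs]
          exact ENNReal.ofReal_le_ofReal (hcol i j hij x hx)
      _ = ENNReal.ofReal (ε' / 3 / (volume.real V + 1)) * ENNReal.ofReal (volume.real V) := by
          rw [setLIntegral_const, ofReal_measureReal hVfin]
      _ ≤ ENNReal.ofReal (ε' / 3) := by
          rw [← ENNReal.ofReal_mul hη.le]
          refine ENNReal.ofReal_le_ofReal ?_
          rw [div_mul_eq_mul_div, div_le_iff₀ (by positivity)]
          nlinarith
  calc ∫⁻ x in V, ‖f i x - f j x‖ₑ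
      ≤ ∫⁻ x in V, (‖S i x - f i x‖ₑ + ‖S i x - S j x‖ₑ + ‖S j x - f j x‖ₑ) := by
        refine lintegral_mono fun x => ?_
        have e : f i x - f j x = -(S i x - f i x) + (S i x - S j x) + (S j x - f j x) := by ring
        rw [e]
        refine (enorm_add_le _ _).trans ?_
        gcongr
        refine (enorm_add_le _ _).trans ?_
        rw [enorm_neg]
    _ = (∫⁻ x in V, ‖S i x - f i x‖ₑ) + (∫⁻ x in V, ‖S i x - S j x‖ₑ) +
          ∫⁻ x in V, ‖S j x - f j x‖ₑ := by
        have h1 : Measurable fun x => ‖S j x - f j x‖ₑ := ((hSm j).sub (hfm j)).enorm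
        have h2 : Measurable fun x => ‖S i x - S j x‖ₑ := ((hSm i).sub (hSm j)).enorm
        rw [lintegral_add_right _ h1, lintegral_add_right _ h2]
    _ ≤ ENNReal.ofReal (ε' / 3) + ENNReal.ofReal (ε' / 3) + ENNReal.ofReal (ε' / 3) := by
        gcongr
        exacts [happrox i, happrox j]
    _ = ENNReal.ofReal ε' := by
        rw [← ENNReal.ofReal_add (by positivity) (by positivity),
          ← ENNReal.ofReal_add (by positivity) (by positivity)]
        congr 1
        ring

/-! ### From magnetic to ordinary variation -/

theorem IsLocallyBounded.exists_norm_le {N : ℕ}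
    {A : EuclideanSpace ℝ (Fin N) → EuclideanSpace ℝ (Fin N)} (hA : IsLocallyBounded A)
    {S : Set (EuclideanSpace ℝ (Fin N))} (hS : Bornology.IsBounded S) :
    ∃ a : ℝ, ∀ x ∈ S, ‖A x‖ ≤ a := by
  have h := hS.isCompact_closure.induction_on (p := fun s => Bornology.IsBounded (A '' s))
    (by simp) (fun s t hst ht => ht.subset (Set.image_mono hst))
    (fun s t hs ht => by rw [Set.image_union]; exact hs.union ht)
    (fun x _ => by
      obtain ⟨U, hU, hb⟩ := hA x
      exact ⟨U, mem_nhdsWithin_of_mem_nhds hU, hb⟩)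
  obtain ⟨a, ha⟩ := h.exists_norm_le
  exact ⟨a, fun x hx => ha _ (Set.mem_image_of_mem A (subset_closure hx))⟩

theorem continuous_divergence {N : ℕ} {Ω : Opens (EuclideanSpace ℝ (Fin N))}
    (φ : 𝓓(Ω, EuclideanSpace ℝ (Fin N))) : Continuous (divergence φ) := by
  have h : Continuous (fderiv ℝ φ) := φ.contDiff.continuous_fderiv (by simp)
  unfold divergence
  fun_prop

theorem exists_abs_divergence_le {N : ℕ} {Ω : Opens (EuclideanSpace ℝ (Fin N))}
    (φ : 𝓓(Ω, EuclideanSpace ℝ (Fin N))) : ∃ D : ℝ, ∀ x, |divergence φ x| ≤ D := by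
  have h : Continuous (fderiv ℝ φ) := φ.contDiff.continuous_fderiv (by simp)
  obtain ⟨B, hB⟩ := h.bounded_above_of_compact_support (φ.hasCompactSupport.fderiv ℝ)
  refine ⟨∑ _i : Fin N, B, fun x => (Finset.abs_sum_le_sum_abs _ _).trans
    (Finset.sum_le_sum fun i _ => ?_)⟩
  refine (PiLp.norm_apply_le (fderiv ℝ φ x (EuclideanSpace.single i 1)) i).trans ?_
  refine (ContinuousLinearMap.le_opNorm _ _).trans ?_
  simpa using hB x

theorem aestronglyMeasurable_inner_testFunction {N : ℕ} {Ω : Opens (EuclideanSpace ℝ (Fin N))}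
    {A : EuclideanSpace ℝ (Fin N) → EuclideanSpace ℝ (Fin N)} (hA : AEStronglyMeasurable A volume)
    (φ : 𝓓(Ω, EuclideanSpace ℝ (Fin N))) :
    AEStronglyMeasurable (fun x => inner ℝ (A x) (φ x)) volume :=
  hA.inner φ.continuous.aestronglyMeasurable

theorem abs_inner_testFunction_le {N : ℕ} {Ω : Opens (EuclideanSpace ℝ (Fin N))}
    {A : EuclideanSpace ℝ (Fin N) → EuclideanSpace ℝ (Fin N)} {a : ℝ} (ha : ∀ x ∈ Ω, ‖A x‖ ≤ a)
    {φ : 𝓓(Ω, EuclideanSpace ℝ (Fin N))} (hφ : ∀ x, ‖φ x‖ ≤ 1) :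
    ∀ᵐ x ∂volume.restrict (Ω : Set (EuclideanSpace ℝ (Fin N))), ‖inner ℝ (A x) (φ x)‖ ≤ a := by
  refine (ae_restrict_iff' Ω.isOpen.measurableSet).2 (Eventually.of_forall fun x hx => ?_)
  calc ‖inner ℝ (A x) (φ x)‖ ≤ ‖A x‖ * ‖φ x‖ := norm_inner_le_norm _ _
    _ ≤ ‖A x‖ := mul_le_of_le_one_right (norm_nonneg _) (hφ x)
    _ ≤ a := ha x hx

/-- A bound on the magnetic variation and on the `L¹` norm gives total boundedness in `L¹`. -/
theorem l1TotallyBounded_of_magnetic_bound {N : ℕ} {Ω : Opens (EuclideanSpace ℝ (Fin N))}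
    (hΩ_bdd : Bornology.IsBounded (Ω : Set (EuclideanSpace ℝ (Fin N))))
    (hΩ_lip : HasLipschitzBoundary Ω)
    {A : EuclideanSpace ℝ (Fin N) → EuclideanSpace ℝ (Fin N)}
    (hA_meas : AEStronglyMeasurable A volume) {a : ℝ} (ha : ∀ x ∈ Ω, ‖A x‖ ≤ a)
    {p q : ℕ → EuclideanSpace ℝ (Fin N) → ℝ}
    (hp : ∀ k, IntegrableOn (p k) (Ω : Set (EuclideanSpace ℝ (Fin N))))
    (hq : ∀ k, IntegrableOn (q k) (Ω : Set (EuclideanSpace ℝ (Fin N)))) {C : ℝ}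
    (hpC : ∀ k, ∫ x in (Ω : Set (EuclideanSpace ℝ (Fin N))), ‖p k x‖ ≤ C)
    (hqC : ∀ k, ∫ x in (Ω : Set (EuclideanSpace ℝ (Fin N))), ‖q k x‖ ≤ C)
    (hC : ∀ k, ∀ φ : 𝓓(Ω, EuclideanSpace ℝ (Fin N)), (∀ x, ‖φ x‖ ≤ 1) →
      ∫ x in (Ω : Set (EuclideanSpace ℝ (Fin N))),
        (p k x * divergence φ x + inner ℝ (A x) (φ x) * q k x) ≤ C) :
    L1TotallyBounded (Ω : Set (EuclideanSpace ℝ (Fin N))) p := by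
  have hms : MeasurableSet (Ω : Set (EuclideanSpace ℝ (Fin N))) := Ω.isOpen.measurableSet
  have hC0 : 0 ≤ C := (integral_nonneg fun x => norm_nonneg _).trans (hpC 0)
  have hint : ∀ k, Integrable ((Ω : Set (EuclideanSpace ℝ (Fin N))).indicator (p k)) := fun k =>
    (integrable_indicator_iff hms).2 (hp k)
  -- A measurable representative of the extension by zero, as required by the exchange of integrals
  -- for the mollification.
  let f : ℕ → EuclideanSpace ℝ (Fin N) → ℝ := fun k => (hint k).aestronglyMeasurable.mk _
  have hfe : ∀ k, (Ω : Set (EuclideanSpace ℝ (Fin N))).indicator (p k) =ᵐ[volume] f k := fun k =>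
    (hint k).aestronglyMeasurable.ae_eq_mk
  have hfp : ∀ k, f k =ᵐ[volume.restrict (Ω : Set (EuclideanSpace ℝ (Fin N)))] p k := fun k =>
    EventuallyEq.trans (EventuallyEq.symm (ae_restrict_of_ae (hfe k)))
      (indicator_ae_eq_restrict hms)
  have hftb : L1TotallyBounded (Ω : Set (EuclideanSpace ℝ (Fin N))) f := by
    refine L1TotallyBounded.of_isCompact hΩ_bdd.isCompact_closure subset_closure fun x hx => ?_
    -- One constant must dominate both the `L¹` norm and the variation; `|a| * C` pays for moving
    -- the magnetic term to the other side.
    refine L1TotallyBounded.of_hasLocalCone (hΩ_lip.hasLocalCone hx) (M := C + |a| * C)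
      (fun k => (hint k).aestronglyMeasurable.stronglyMeasurable_mk.measurable)
      (fun k => (hint k).congr (hfe k)) (fun k => ?_) (fun k φ hφ => ?_)
    · calc ∫ x, ‖f k x‖
          = ∫ x, ‖(Ω : Set (EuclideanSpace ℝ (Fin N))).indicator (p k) x‖ :=
            integral_congr_ae ((hfe k).symm.mono fun x hx => by simp only [hx])
        _ = ∫ x in (Ω : Set (EuclideanSpace ℝ (Fin N))), ‖p k x‖ := by
            simp only [norm_indicator_eq_indicator_norm]
            exact integral_indicator hms
        _ ≤ C + |a| * C := (hpC k).trans (le_add_of_nonneg_right (by positivity))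
    · obtain ⟨D, hD⟩ := exists_abs_divergence_le φ
      have hin := abs_inner_testFunction_le ha hφ
      have h1 : IntegrableOn (fun x => p k x * divergence φ x)
          (Ω : Set (EuclideanSpace ℝ (Fin N))) :=
        (hp k).mul_bdd (c := D) (continuous_divergence φ).aestronglyMeasurable
          (Eventually.of_forall hD)
      have h2 : IntegrableOn (fun x => inner ℝ (A x) (φ x) * q k x)
          (Ω : Set (EuclideanSpace ℝ (Fin N))) :=
        (hq k).bdd_mul (c := a) (aestronglyMeasurable_inner_testFunction hA_meas φ).restrict hin
      have h3 : ‖∫ x in (Ω : Set (EuclideanSpace ℝ (Fin N))), inner ℝ (A x) (φ x) * q k x‖ ≤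
          |a| * C := by
        refine (norm_integral_le_of_norm_le ((hq k).norm.const_mul |a|) ?_).trans ?_
        · filter_upwards [hin] with x hx
          rw [norm_mul]
          exact mul_le_mul_of_nonneg_right (hx.trans (le_abs_self a)) (norm_nonneg _)
        · rw [integral_const_mul]
          exact mul_le_mul_of_nonneg_left (hqC k) (abs_nonneg a)
      have h4 := hC k φ hφ
      rw [integral_add h1 h2] at h4
      calc ∫ x, f k x * divergence φ x
          = ∫ x, (Ω : Set (EuclideanSpace ℝ (Fin N))).indicator
              (fun x => p k x * divergence φ x) x :=
            integral_congr_ae ((hfe k).symm.mono fun x hx => by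
              simp only [hx, Set.indicator_mul_left])
        _ = ∫ x in (Ω : Set (EuclideanSpace ℝ (Fin N))), p k x * divergence φ x :=
            integral_indicator hms
        _ ≤ C + |a| * C := by linarith [(abs_le.1 h3).1]
  intro ε hε
  obtain ⟨T, hT, c, hc⟩ := hftb ε hε
  refine ⟨T, hT, c, fun i j hij => le_trans (le_of_eq (lintegral_congr_ae ?_)) (hc i j hij)⟩
  filter_upwards [hfp i, hfp j] with x hi hj
  rw [hi, hj]

/-! ### Convergent subsequences and passage to the limit -/

/-- A sequence of complex functions whose real and imaginary parts are totally bounded in `L¹`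
has a subsequence converging in `L¹`. -/
theorem exists_subseq_tendsto_of_l1TotallyBounded {E : Type*} [MeasureSpace E] {V : Set E}
    {u : ℕ → E → ℂ} (hu : ∀ k, IntegrableOn (u k) V)
    (hre : L1TotallyBounded V fun k x => (u k x).re)
    (him : L1TotallyBounded V fun k x => (u k x).im) :
    ∃ (σ : ℕ → ℕ) (v : E → ℂ), StrictMono σ ∧ IntegrableOn v V ∧
      Tendsto (fun j => ∫⁻ x in V, ‖u (σ j) x - v x‖ₑ) atTop (𝓝 0) := by
  let F : ℕ → Lp ℂ 1 (volume.restrict V) := fun k => (hu k).toL1 (u k)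
  have htb : TotallyBounded (Set.range F) := by
    rw [Metric.totallyBounded_iff]
    intro ε hε
    have hε3 : 0 < ENNReal.ofReal (ε / 3) := ENNReal.ofReal_pos.2 (by positivity)
    obtain ⟨T₁, hT₁, c₁, hc₁⟩ := hre _ hε3
    obtain ⟨T₂, hT₂, c₂, hc₂⟩ := him _ hε3
    let c : ℕ → T₁ × T₂ := fun i => (c₁ i, c₂ i)
    -- The net has one centre for each colour that occurs, namely a chosen member of that colour
    -- class.
    refine ⟨Set.range fun τ : Set.range c => F τ.2.choose, Set.finite_range _, ?_⟩
    rintro _ ⟨i, rfl⟩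
    refine Set.mem_iUnion₂.2 ⟨_, ⟨⟨c i, i, rfl⟩, rfl⟩, ?_⟩
    have hex : ∃ j, c j = c i := ⟨i, rfl⟩
    have hj : c hex.choose = c i := hex.choose_spec
    change dist (F i) (F hex.choose) < ε
    generalize hex.choose = j at hj
    simp only [c, Prod.mk.injEq] at hj
    have hle : edist (F i) (F j) ≤ ENNReal.ofReal (ε / 3) + ENNReal.ofReal (ε / 3) := by
      rw [show edist (F i) (F j) = _ from Integrable.edist_toL1_toL1 _ _ (hu i) (hu j)]
      calc ∫⁻ x in V, edist (u i x) (u j x)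
          ≤ ∫⁻ x in V, (‖(u i x).re - (u j x).re‖ₑ + ‖(u i x).im - (u j x).im‖ₑ) := by
            refine lintegral_mono fun x => ?_
            simp only [edist_eq_enorm_sub, ← Complex.sub_re, ← Complex.sub_im]
            simp only [← ofReal_norm, ← ENNReal.ofReal_add (norm_nonneg _) (norm_nonneg _)]
            exact ENNReal.ofReal_le_ofReal (Complex.norm_le_abs_re_add_abs_im _)
        _ = (∫⁻ x in V, ‖(u i x).re - (u j x).re‖ₑ) + ∫⁻ x in V, ‖(u i x).im - (u j x).im‖ₑ :=
            lintegral_add_left' ((hu i).re.sub (hu j).re).aestronglyMeasurable.enorm _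
        _ ≤ _ := add_le_add (hc₁ i j hj.1.symm) (hc₂ i j hj.2.symm)
    rw [← ENNReal.ofReal_add (by positivity) (by positivity), edist_dist,
      ENNReal.ofReal_le_ofReal_iff (by positivity)] at hle
    linarith
  obtain ⟨w, -, σ, hσ, hlim⟩ := (htb.closure.isCompact_of_isClosed isClosed_closure).tendsto_subseq
    (x := F) fun n => subset_closure ⟨n, rfl⟩
  have hw : IntegrableOn w V := L1.integrable_coeFn w
  refine ⟨σ, w, hσ, hw, ?_⟩
  have h := (tendsto_iff_edist_tendsto_0 ..).1 hlim
  refine h.congr fun j => ?_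
  have h1 := Integrable.edist_toL1_toL1 _ _ (hu (σ j)) hw
  rw [Integrable.toL1_coeFn w hw] at h1
  simp only [edist_eq_enorm_sub (u _ _)] at h1
  exact h1

/-- Multiplication by `m` expands `L¹` distances by at most the factor `D`. It is used with `m`
equal to `div φ` and to `A · φ`. -/
theorem tendsto_integral_mul_of_tendsto_L1 {E : Type*} [MeasurableSpace E] {μ : Measure E}
    {p : ℕ → E → ℝ} {p' m : E → ℝ} (hp : ∀ k, Integrable (p k) μ) (hp' : Integrable p' μ)
    (hlim : Tendsto (fun k => ∫⁻ x, ‖p k x - p' x‖ₑ ∂μ) atTop (𝓝 0))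
    (hm : AEStronglyMeasurable m μ) {D : ℝ} (hD : ∀ᵐ x ∂μ, ‖m x‖ ≤ D) :
    Tendsto (fun k => ∫ x, p k x * m x ∂μ) atTop (𝓝 (∫ x, p' x * m x ∂μ)) := by
  refine tendsto_integral_of_L1 _ (hp'.mul_bdd (c := D) hm hD).aestronglyMeasurable
    (Eventually.of_forall fun k => (hp k).mul_bdd (c := D) hm hD) ?_
  have h0 : Tendsto (fun k => ENNReal.ofReal D * ∫⁻ x, ‖p k x - p' x‖ₑ ∂μ) atTop (𝓝 0) := by
    simpa using ENNReal.Tendsto.const_mul hlim (Or.inr ENNReal.ofReal_ne_top)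
  refine tendsto_of_tendsto_of_tendsto_of_le_of_le tendsto_const_nhds h0
    (fun _ => zero_le) fun k => ?_
  rw [← lintegral_const_mul' _ _ ENNReal.ofReal_ne_top]
  refine lintegral_mono_ae (hD.mono fun x hx => ?_)
  rw [← sub_mul, enorm_mul, mul_comm]
  gcongr
  rw [← ofReal_norm]
  exact ENNReal.ofReal_le_ofReal hx

/-- Bounds on the magnetic variation pass to `L¹` limits. -/
theorem integral_magnetic_le_of_tendsto {N : ℕ} {Ω : Opens (EuclideanSpace ℝ (Fin N))}
    {A : EuclideanSpace ℝ (Fin N) → EuclideanSpace ℝ (Fin N)}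
    (hA_meas : AEStronglyMeasurable A volume) {a : ℝ} (ha : ∀ x ∈ Ω, ‖A x‖ ≤ a)
    {p q : ℕ → EuclideanSpace ℝ (Fin N) → ℝ} {p' q' : EuclideanSpace ℝ (Fin N) → ℝ}
    (hp : ∀ k, IntegrableOn (p k) (Ω : Set (EuclideanSpace ℝ (Fin N))))
    (hq : ∀ k, IntegrableOn (q k) (Ω : Set (EuclideanSpace ℝ (Fin N))))
    (hp' : IntegrableOn p' (Ω : Set (EuclideanSpace ℝ (Fin N))))
    (hq' : IntegrableOn q' (Ω : Set (EuclideanSpace ℝ (Fin N))))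
    (hlim_p : Tendsto (fun k => ∫⁻ x in (Ω : Set (EuclideanSpace ℝ (Fin N))), ‖p k x - p' x‖ₑ)
      atTop (𝓝 0))
    (hlim_q : Tendsto (fun k => ∫⁻ x in (Ω : Set (EuclideanSpace ℝ (Fin N))), ‖q k x - q' x‖ₑ)
      atTop (𝓝 0))
    {φ : 𝓓(Ω, EuclideanSpace ℝ (Fin N))} (hφ : ∀ x, ‖φ x‖ ≤ 1) {C : ℝ}
    (hC : ∀ k, ∫ x in (Ω : Set (EuclideanSpace ℝ (Fin N))),
        (p k x * divergence φ x + inner ℝ (A x) (φ x) * q k x) ≤ C) :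
    ∫ x in (Ω : Set (EuclideanSpace ℝ (Fin N))),
        (p' x * divergence φ x + inner ℝ (A x) (φ x) * q' x) ≤ C := by
  obtain ⟨D, hD⟩ := exists_abs_divergence_le φ
  have hin := abs_inner_testFunction_le ha hφ
  have hdm : AEStronglyMeasurable (divergence φ)
      (volume.restrict (Ω : Set (EuclideanSpace ℝ (Fin N)))) :=
    (continuous_divergence φ).aestronglyMeasurable
  have him : AEStronglyMeasurable (fun x => inner ℝ (A x) (φ x))
      (volume.restrict (Ω : Set (EuclideanSpace ℝ (Fin N)))) :=
    (aestronglyMeasurable_inner_testFunction hA_meas φ).restrict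
  have hDae : ∀ᵐ x ∂volume.restrict (Ω : Set (EuclideanSpace ℝ (Fin N))), ‖divergence φ x‖ ≤ D :=
    Eventually.of_forall hD
  have h := (tendsto_integral_mul_of_tendsto_L1 hp hp' hlim_p hdm hDae).add
    (tendsto_integral_mul_of_tendsto_L1 hq hq' hlim_q him hin)
  simp only [mul_comm _ (inner ℝ (A _) (φ _))] at h
  rw [← integral_add (hp'.mul_bdd hdm hDae) (hq'.bdd_mul him hin)] at h
  refine le_of_tendsto' h fun k => ?_
  rw [← integral_add ((hp k).mul_bdd hdm hDae) ((hq k).bdd_mul him hin)]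
  exact hC k

/-! ### Unpacking the norms -/

variable {N : ℕ} {A : EuclideanSpace ℝ (Fin N) → EuclideanSpace ℝ (Fin N)}
  {Ω : Opens (EuclideanSpace ℝ (Fin N))} {u : EuclideanSpace ℝ (Fin N) → ℂ}

/-- The minus sign is carried by the imaginary part, so that both variations take the form `p div φ
+ (A · φ) q`, with `(p, q)` equal to `(Re u, -Im u)` here and to `(Im u, Re u)` for the other. -/
theorem integral_le_of_variationRe_le {C : ℝ≥0} (h : variationRe A Ω u ≤ C)
    {φ : 𝓓(Ω, EuclideanSpace ℝ (Fin N))} (hφ : ∀ x, ‖φ x‖ ≤ 1) :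
    ∫ x in (Ω : Set (EuclideanSpace ℝ (Fin N))),
      ((u x).re * divergence φ x + inner ℝ (A x) (φ x) * -(u x).im) ≤ C := by
  have h1 := (le_iSup₂ (f := fun (φ : 𝓓(Ω, EuclideanSpace ℝ (Fin N))) (_ : ∀ x, ‖φ x‖ ≤ 1) =>
    ENNReal.ofReal (∫ x in (Ω : Set (EuclideanSpace ℝ (Fin N))),
      ((u x).re * divergence φ x - inner ℝ (A x) (φ x) * (u x).im))) φ hφ).trans h
  simp only [mul_neg, ← sub_eq_add_neg]
  simpa using ENNReal.ofReal_le_iff_le_toReal ENNReal.coe_ne_top |>.1 h1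

theorem integral_le_of_variationIm_le {C : ℝ≥0} (h : variationIm A Ω u ≤ C)
    {φ : 𝓓(Ω, EuclideanSpace ℝ (Fin N))} (hφ : ∀ x, ‖φ x‖ ≤ 1) :
    ∫ x in (Ω : Set (EuclideanSpace ℝ (Fin N))),
      ((u x).im * divergence φ x + inner ℝ (A x) (φ x) * (u x).re) ≤ C := by
  have h1 := (le_iSup₂ (f := fun (φ : 𝓓(Ω, EuclideanSpace ℝ (Fin N))) (_ : ∀ x, ‖φ x‖ ≤ 1) =>
    ENNReal.ofReal (∫ x in (Ω : Set (EuclideanSpace ℝ (Fin N))),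
      ((u x).im * divergence φ x + inner ℝ (A x) (φ x) * (u x).re))) φ hφ).trans h
  simpa using ENNReal.ofReal_le_iff_le_toReal ENNReal.coe_ne_top |>.1 h1

theorem integral_norm_le_of_lintegral_enorm_le {E : Type*} [MeasurableSpace E] {μ : Measure E}
    {f : E → ℝ} (hf : Integrable f μ) {C : ℝ≥0} (h : ∫⁻ x, ‖f x‖ₑ ∂μ ≤ C) :
    ∫ x, ‖f x‖ ∂μ ≤ C := by
  rw [integral_norm_eq_lintegral_enorm hf.aestronglyMeasurable]
  simpa using ENNReal.toReal_mono ENNReal.coe_ne_top h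

theorem lintegral_enorm_re_le_l1Norm :
    ∫⁻ x in (Ω : Set (EuclideanSpace ℝ (Fin N))), ‖(u x).re‖ₑ ≤ l1Norm Ω u :=
  lintegral_mono fun _ => le_self_add

theorem lintegral_enorm_im_le_l1Norm :
    ∫⁻ x in (Ω : Set (EuclideanSpace ℝ (Fin N))), ‖(u x).im‖ₑ ≤ l1Norm Ω u :=
  lintegral_mono fun _ => le_add_self

theorem l1Norm_le_two_mul :
    l1Norm Ω u ≤ 2 * ∫⁻ x in (Ω : Set (EuclideanSpace ℝ (Fin N))), ‖u x‖ₑ := by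
  rw [← lintegral_const_mul' _ _ (by simp)]
  refine lintegral_mono fun x => ?_
  rw [two_mul]
  refine add_le_add ?_ ?_ <;> simp only [← ofReal_norm]
  · exact ENNReal.ofReal_le_ofReal (Complex.abs_re_le_norm _)
  · exact ENNReal.ofReal_le_ofReal (Complex.abs_im_le_norm _)

end MagneticBV

/-! ### The compactness theorem -/

open MagneticBV in
theorem mainTheorem6 {N : ℕ} (Ω : Opens (EuclideanSpace ℝ (Fin N)))
    (hΩ_bdd : Bornology.IsBounded (Ω : Set (EuclideanSpace ℝ (Fin N))))
    (hΩ_lip : MagneticBV.HasLipschitzBoundary Ω)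
    (A : EuclideanSpace ℝ (Fin N) → EuclideanSpace ℝ (Fin N))
    (hA_meas : AEStronglyMeasurable A volume)
    (hA_bdd : MagneticBV.IsLocallyBounded A)
    (u : ℕ → EuclideanSpace ℝ (Fin N) → ℂ)
    (hu_mem : ∀ k, MagneticBV.MemBV A Ω (u k))
    (hu_bdd : ∃ C : ℝ≥0, ∀ k, MagneticBV.bvNorm A Ω (u k) ≤ C) :
    ∃ (σ : ℕ → ℕ) (v : EuclideanSpace ℝ (Fin N) → ℂ), StrictMono σ ∧
      MagneticBV.MemBV A Ω v ∧
      Tendsto (fun j => MagneticBV.l1Norm Ω (u (σ j) - v)) atTop (𝓝 0) := by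
  obtain ⟨C, hC⟩ := hu_bdd
  obtain ⟨a, ha⟩ := hA_bdd.exists_norm_le hΩ_bdd
  have hu : ∀ k, IntegrableOn (u k) (Ω : Set (EuclideanSpace ℝ (Fin N))) := fun k => (hu_mem k).1
  have hre : ∀ k, IntegrableOn (fun x => (u k x).re) (Ω : Set (EuclideanSpace ℝ (Fin N))) :=
    fun k => (hu k).re
  have him : ∀ k, IntegrableOn (fun x => (u k x).im) (Ω : Set (EuclideanSpace ℝ (Fin N))) :=
    fun k => (hu k).im
  have hL : ∀ k, l1Norm Ω (u k) ≤ C := fun k => le_self_add.trans (hC k)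
  have hV : ∀ k, variation A Ω (u k) ≤ C := fun k => le_add_self.trans (hC k)
  have hVre : ∀ k, variationRe A Ω (u k) ≤ C := fun k => le_self_add.trans (hV k)
  have hVim : ∀ k, variationIm A Ω (u k) ≤ C := fun k => le_add_self.trans (hV k)
  have hreC := fun k => integral_norm_le_of_lintegral_enorm_le (hre k)
    (lintegral_enorm_re_le_l1Norm.trans (hL k))
  have himC := fun k => integral_norm_le_of_lintegral_enorm_le (him k)
    (lintegral_enorm_im_le_l1Norm.trans (hL k))
  have htre := l1TotallyBounded_of_magnetic_bound hΩ_bdd hΩ_lip hA_meas ha hre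
    (fun k => (him k).neg) hreC (fun k => by simpa using himC k)
    (fun k φ hφ => integral_le_of_variationRe_le (hVre k) hφ)
  have htim := l1TotallyBounded_of_magnetic_bound hΩ_bdd hΩ_lip hA_meas ha him hre himC hreC
    (fun k φ hφ => integral_le_of_variationIm_le (hVim k) hφ)
  obtain ⟨σ, v, hσ, hv, hlim⟩ := exists_subseq_tendsto_of_l1TotallyBounded hu htre htim
  have hl1 : Tendsto (fun j => l1Norm Ω (u (σ j) - v)) atTop (𝓝 0) := by
    have h2 := ENNReal.Tendsto.const_mul (a := 2) hlim (Or.inr (by simp))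
    rw [mul_zero] at h2
    exact tendsto_of_tendsto_of_tendsto_of_le_of_le tendsto_const_nhds h2 (fun _ => zero_le)
      fun _ => l1Norm_le_two_mul
  have hlre : Tendsto (fun j => ∫⁻ x in (Ω : Set (EuclideanSpace ℝ (Fin N))),
      ‖(u (σ j) x).re - (v x).re‖ₑ) atTop (𝓝 0) :=
    tendsto_of_tendsto_of_tendsto_of_le_of_le tendsto_const_nhds hl1 (fun _ => zero_le)
      fun j => lintegral_enorm_re_le_l1Norm (u := u (σ j) - v)
  have hlim' : Tendsto (fun j => ∫⁻ x in (Ω : Set (EuclideanSpace ℝ (Fin N))),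
      ‖(u (σ j) x).im - (v x).im‖ₑ) atTop (𝓝 0) :=
    tendsto_of_tendsto_of_tendsto_of_le_of_le tendsto_const_nhds hl1 (fun _ => zero_le)
      fun j => lintegral_enorm_im_le_l1Norm (u := u (σ j) - v)
  have hlneg : Tendsto (fun j => ∫⁻ x in (Ω : Set (EuclideanSpace ℝ (Fin N))),
      ‖-(u (σ j) x).im - -(v x).im‖ₑ) atTop (𝓝 0) := by
    refine hlim'.congr fun j => lintegral_congr fun x => ?_
    rw [← enorm_neg]
    congr 1
    ring
  refine ⟨σ, v, hσ, ⟨hv, ?_⟩, hl1⟩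
  -- Lower semicontinuity: the bound passes to the limit for each fixed `φ`, and the supremum is
  -- taken afterwards.
  have hvre : variationRe A Ω v ≤ C := by
    refine iSup₂_le fun φ hφ => ?_
    rw [← ENNReal.ofReal_coe_nnreal]
    refine ENNReal.ofReal_le_ofReal ?_
    have h := integral_magnetic_le_of_tendsto hA_meas ha (fun j => hre (σ j))
      (fun j => (him (σ j)).neg) hv.re hv.im.neg hlre hlneg hφ
      (fun j => integral_le_of_variationRe_le (hVre (σ j)) hφ)
    simpa [sub_eq_add_neg] using h
  have hvim : variationIm A Ω v ≤ C := by
    refine iSup₂_le fun φ hφ => ?_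
    rw [← ENNReal.ofReal_coe_nnreal]
    exact ENNReal.ofReal_le_ofReal (integral_magnetic_le_of_tendsto hA_meas ha
      (fun j => him (σ j)) (fun j => hre (σ j)) hv.im hv.re hlim' hlre hφ
      (fun j => integral_le_of_variationIm_le (hVim (σ j)) hφ))
  exact (add_le_add hvre hvim).trans_lt (by simp)
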